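/- Let $\Omega\subset\mathbb R^2$ be a bounded simply connected domain with smooth boundary, $L>0$, $D=\Omega\times(0,L)$, and write $\hat x=(x_1,x_2)$, $\hat C=(C^1,C^2)$ for vectors of $\mathbb R^3$. Let $h_0\ge 0$, $\vec a(x)=\frac12(-x_2,x_1,0)$, and let $\varepsilon\mapsto h_{ex}(\varepsilon)$ satisfy $\lim_{\varepsilon\to0^+}h_{ex}/|\ln\varepsilon|=h_0$. Let $V$ be the space of $v\in L^2(D;\mathbb R^2)$ whose distributional curl $\partial_1v^2-\partial_2v^1$ is a finite Radon measure on $D$, and let $K_0$ be the space of $\vec C\in H^1_{loc}(\mathbb R^3;\mathbb R^3)$ with $\nabla\times\vec C-h_0\vec e_3\in L^2(\mathbb R^3;\mathbb R^3)$, $\nabla\cdot\vec C=0$ and $\vec C-h_0\vec a\in\check H^1(\mathbb R^3;\mathbb R^3)\cap L^6(\mathbb R^3;\mathbb R^3)$, where $\check H^1$ is the completion of $C_0^\infty$ in the norm $\|\nabla\vec C\|_{L^2(\mathbb R^3)}$. Let $(v_0,\vec A_0)\in V\times K_0$ be a minimizer over $V\times K_0$ of $$\mathcal G_{h_0}(v,\vec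 A)=\tfrac12\Big[\|v-\hat A\|_{L^2(D)}^2+|\mathrm{curl}\,v|(D)+\|\nabla\times\vec A-h_0\vec e_3\|_{L^2(\mathbb R^3)}^2\Big].$$ For $0<\varepsilon<1$ put $\vec A^\varepsilon=|\ln\varepsilon|\,\vec A_0+(h_{ex}-h_0|\ln\varepsilon|)\,\vec a$. Then $\hat A^\varepsilon$ has a Sobolev trace (the extension by density of the restriction of smooth functions) on every plane $\{x_3=c\}$, which is the restriction $\hat x\mapsto\hat A^\varepsilon(\hat x,c)$ of the continuous representative whenever $\hat A^\varepsilon$ has one. For $N\ge1$, $s=L/N$ and $0\le n<N$, let $\hat A^\varepsilon_n$ be the trace of $\hat A^\varepsilon$ on $\{x_3=ns\}$, and let $\chi_0$ and $\chi_n$ ($n\ge 1$) be the characteristic functions of $(0,s)$ and $[ns,(n+1)s)$ in the variable $x_3$. Then $\hat A_0\in L^2(D;\mathbb R^2)$, $\hat A^{\varepsilon,s}:=\sum_{n=0}^{N-1}\frac{\hat A^\varepsilon_n}{|\ln\varepsilon|}\chi_n\in L^2(D;\mathbb R^2)$, and $$\hat A^{\varepsilon,s}\longrightarrow\hat A_0\quad\text{in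 }L^2(D;\mathbb R^2)\quad\text{as }(\varepsilon,s)\to(0,0)$$ (jointly, with no condition on the relative size of $\varepsilon$ and $s=L/N$). -/

import Mathlib

open MeasureTheory Filter Topology Set
open scoped ENNReal ContDiff

noncomputable section

namespace LawrenceDoniach

abbrev E2 : Type := EuclideanSpace ℝ (Fin 2)

abbrev E3 : Type := EuclideanSpace ℝ (Fin 3)

/-- The first two components of a vector of `ℝ³`. -/
def hat (x : E3) : E2 := !₂[x 0, x 1]

/-- The point of `ℝ³` with horizontal part `y` and height `c`. -/
def atHeight (y : E2) (c : ℝ) : E3 := !₂[y 0, y 1, c]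

/-- A domain of `ℝ²` that is bounded, simply connected (hence nonempty and connected) and has a
smooth boundary: near each boundary point it is a sublevel set of a smooth function with
non-vanishing differential. -/
structure IsSmoothSimplyConnectedDomain (Ω : Set E2) : Prop where
  isOpen : IsOpen Ω
  bounded : Bornology.IsBounded Ω
  simplyConnected : SimplyConnectedSpace Ω
  smoothBoundary : ∀ p ∈ frontier Ω, ∃ (U : Set E2) (ρ : E2 → ℝ), IsOpen U ∧ p ∈ U ∧
    ContDiff ℝ ∞ ρ ∧ fderiv ℝ ρ p ≠ 0 ∧ Ω ∩ U = {x | ρ x < 0} ∩ U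

/-- The cylinder `Ω × (0, L)`. -/
def layeredDomain (Ω : Set E2) (L : ℝ) : Set E3 := {x | hat x ∈ Ω ∧ x 2 ∈ Ioo 0 L}

/-! ### Weak derivatives and function spaces on `ℝ³` -/

/-- The classical `j`-th partial derivative. -/
def partialD (j : Fin 3) (φ : E3 → ℝ) (x : E3) : ℝ :=
  fderiv ℝ φ x (EuclideanSpace.single j 1)

/-- `φ ∈ C_c^∞(ℝ³)`. -/
def IsTestFunction (φ : E3 → ℝ) : Prop := ContDiff ℝ ∞ φ ∧ HasCompactSupport φ

/-- `g` is a weak `j`-th partial derivative of `f` on `ℝ³`. -/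
def HasWeakPartial (j : Fin 3) (f g : E3 → ℝ) : Prop :=
  LocallyIntegrable f ∧ LocallyIntegrable g ∧
    ∀ φ : E3 → ℝ, IsTestFunction φ → ∫ x, f x * partialD j φ x = -∫ x, g x * φ x

open Classical in
/-- The weak `j`-th partial derivative of `f` (unique up to null sets where it exists). -/
def weakPartial (j : Fin 3) (f : E3 → ℝ) : E3 → ℝ :=
  if h : ∃ g, HasWeakPartial j f g then h.choose else 0

/-- `f ∈ L²_loc`. -/
def MemL2loc {X F : Type*} [TopologicalSpace X] [MeasureSpace X] [NormedAddCommGroup F]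
    (f : X → F) : Prop :=
  ∀ K : Set X, IsCompact K → MemLp f 2 (volume.restrict K)

/-- `f ∈ H¹_loc(ℝ³)`. -/
def MemH1loc (f : E3 → ℝ) : Prop :=
  MemL2loc f ∧ ∀ j, (∃ g, HasWeakPartial j f g) ∧ MemL2loc (weakPartial j f)

/-- `f` has a weak gradient in `L²(ℝ³)` which is the `L²` limit of gradients of test functions,
that is, `f` represents an element of the completion of `C_c^∞(ℝ³)` in the norm `‖∇f‖_{L²}`. -/
def MemHcheck (f : E3 → ℝ) : Prop :=
  (∀ j, (∃ g, HasWeakPartial j f g) ∧ MemLp (weakPartial j f) 2 volume) ∧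
    ∃ φ : ℕ → E3 → ℝ, (∀ k, IsTestFunction (φ k)) ∧
      ∀ j, Tendsto (fun k => eLpNorm (fun x => partialD j (φ k) x - weakPartial j f x) 2 volume)
        atTop (𝓝 0)

/-- The (weak) curl of a vector field on `ℝ³`. -/
def curl (A : E3 → E3) (x : E3) : E3 :=
  !₂[weakPartial 1 (fun y => A y 2) x - weakPartial 2 (fun y => A y 1) x,
     weakPartial 2 (fun y => A y 0) x - weakPartial 0 (fun y => A y 2) x,
     weakPartial 0 (fun y => A y 1) x - weakPartial 1 (fun y => A y 0) x]

/-- The (weak) divergence of a vector field on `ℝ³`. -/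
def div (A : E3 → E3) (x : E3) : ℝ := ∑ j, weakPartial j (fun y => A y j) x

def e3 : E3 := !₂[0, 0, 1]

/-- The vector field `a(x) = (-x₂, x₁, 0) / 2`, whose curl is `e₃`. -/
def aField (x : E3) : E3 := !₂[-(x 1) / 2, x 0 / 2, 0]

/-- The space `E₀` of `H¹_loc` fields whose curl differs from `h₀ e₃` by an `L²` field. -/
def MemE0 (h₀ : ℝ) (A : E3 → E3) : Prop :=
  (∀ i, MemH1loc (fun x => A x i)) ∧ MemLp (fun x => curl A x - h₀ • e3) 2 volume

/-- The Coulomb gauge space `K₀`. -/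
def MemK0 (h₀ : ℝ) (A : E3 → E3) : Prop :=
  MemE0 h₀ A ∧ (∀ᵐ x, div A x = 0) ∧
    (∀ i, MemHcheck (fun x => (A x - h₀ • aField x) i)) ∧
    MemLp (fun x => A x - h₀ • aField x) 6 volume

/-! ### The space `V` and the limiting functional -/

/-- The signed measure `μ` is, on the open set `D`, the distributional horizontal curl
`∂₁v² - ∂₂v¹` of `v`. -/
def IsCurlMeasure (D : Set E3) (v : E3 → E2) (μ : SignedMeasure E3) : Prop :=
  ∀ φ : E3 → ℝ, IsTestFunction φ → tsupport φ ⊆ D →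
    (∫ x, φ x ∂μ.toJordanDecomposition.posPart) - (∫ x, φ x ∂μ.toJordanDecomposition.negPart)
      = ∫ x in D, (v x 0 * partialD 1 φ x - v x 1 * partialD 0 φ x)

/-- `v ∈ L²(D; ℝ²)` with `curl v` a finite Radon measure on `D`. -/
def MemV (D : Set E3) (v : E3 → E2) : Prop :=
  MemLp v 2 (volume.restrict D) ∧ ∃ μ, IsCurlMeasure D v μ

/-- `|curl v|(D)`, equal to `∞` if `curl v` is not a finite measure on `D` (the measure is
determined on `D` by `v`, so that the infimum is over at most one value). -/
def curlVariation (D : Set E3) (v : E3 → E2) : ℝ≥0∞ :=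
  ⨅ (μ : SignedMeasure E3) (_ : IsCurlMeasure D v μ), μ.totalVariation D

/-- The limiting functional
`½ (‖v - Â‖²_{L²(D)} + |curl v|(D) + ‖∇ × A - h₀ e₃‖²_{L²(ℝ³)})`. -/
def limitEnergy (D : Set E3) (h₀ : ℝ) (v : E3 → E2) (A : E3 → E3) : ℝ≥0∞ :=
  2⁻¹ * (eLpNorm (fun x => v x - hat (A x)) 2 (volume.restrict D) ^ 2 + curlVariation D v
    + eLpNorm (fun x => curl A x - h₀ • e3) 2 volume ^ 2)

/-- `(v₀, A₀)` minimizes the limiting functional over `V × K₀`. -/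
def IsMinimizer (D : Set E3) (h₀ : ℝ) (v₀ : E3 → E2) (A₀ : E3 → E3) : Prop :=
  MemV D v₀ ∧ MemK0 h₀ A₀ ∧
    ∀ v A, MemV D v → MemK0 h₀ A → limitEnergy D h₀ v₀ A₀ ≤ limitEnergy D h₀ v A

/-! ### Traces on horizontal planes and the layer sums -/

/-- `T` is the Sobolev trace of `f ∈ H¹_loc(ℝ³)` on the plane `x₃ = c`: the `L²_loc` limit of the
restrictions to the plane of smooth functions that converge to `f` in `H¹_loc(ℝ³)`. -/
def IsTrace (f : E3 → ℝ) (c : ℝ) (T : E2 → ℝ) : Prop :=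
  MemH1loc f ∧ MemL2loc T ∧ ∃ φ : ℕ → E3 → ℝ, (∀ k, ContDiff ℝ ∞ (φ k)) ∧
    (∀ K : Set E3, IsCompact K →
      Tendsto (fun k => eLpNorm (fun x => φ k x - f x) 2 (volume.restrict K)) atTop (𝓝 0) ∧
      ∀ j, Tendsto (fun k => eLpNorm (fun x => partialD j (φ k) x - weakPartial j f x) 2
        (volume.restrict K)) atTop (𝓝 0)) ∧
    ∀ K : Set E2, IsCompact K →
      Tendsto (fun k => eLpNorm (fun y => φ k (atHeight y c) - T y) 2 (volume.restrict K))
        atTop (𝓝 0)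

/-- `T` is the trace of the horizontal part `(A¹, A²)` of `A` on the plane `x₃ = c`. -/
def IsHatTrace (A : E3 → E3) (c : ℝ) (T : E2 → E2) : Prop :=
  IsTrace (fun x => A x 0) c (fun y => T y 0) ∧ IsTrace (fun x => A x 1) c (fun y => T y 1)

/-- `χ_n`: the characteristic function of `(0, s)` for `n = 0`, of `[ns, (n+1)s)` for `n ≥ 1`. -/
def chi (s : ℝ) (n : ℕ) : ℝ → ℝ :=
  (if n = 0 then Ioo 0 s else Ico (n * s) ((n + 1) * s)).indicator 1

/-- `A^ε = |ln ε| A₀ + (h_ex - h₀ |ln ε|) a`. -/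
def Aeps (h₀ hex ε : ℝ) (A₀ : E3 → E3) (x : E3) : E3 :=
  |Real.log ε| • A₀ x + (hex - h₀ * |Real.log ε|) • aField x

/-- `∑_{n=0}^{N-1} (T_n / |ln ε|) χ_n` with layer distance `s`. -/
def layerSum (ε s : ℝ) (N : ℕ) (T : ℕ → E2 → E2) (x : E3) : E2 :=
  ∑ n ∈ Finset.range N, chi s n (x 2) • (|Real.log ε|⁻¹ • T n (hat x))

end LawrenceDoniach

end

open LawrenceDoniach

/-! The argument is a one-dimensional Poincaré estimate on thin layers, and it rests on the
components of $A_0$ lying in $H^1_{loc}(\mathbb R^3)$. If $T$ is the trace of $f\in H^1_{loc}$ on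
the lower face of a layer of thickness $s$, the fundamental theorem of calculus on vertical segments
and Cauchy–Schwarz bound $\|T-f\|_{L^2}$ on the layer by $s\|\partial_3 f\|_{L^2}$ on the same layer
(`eLpNorm_sub_slice_le` for smooth $f$, `IsTrace.eLpNorm_sub_le` by density). Since the layers are
disjoint, squares add up and the same constant $s$ serves on all of $D$
(`eLpNorm_layeredSum_sub_le`).

Write $A^\varepsilon = lA_0 + da$ with $l=|\ln\varepsilon|$ and $d=h_{ex}-h_0l$. As $a$ does not
depend on $x_3$, $\partial_3A^\varepsilon=l\,\partial_3A_0$. Dividing by $l$, the layer sum differs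
from $A_0$, component by component, by at most $s\|\partial_3A_0\|+|h_{ex}/l-h_0|\,\|a\|$ in
$L^2(D)$ (`eLpNorm_layeredSum_rescaled_le`). One term depends on $s$ only, the other on
$\varepsilon$ only, hence the joint limit.

Traces come from mollification, which converges in $H^1_{loc}$. For smooth $\varphi$ the value
$\varphi(y,c)$ is an integral over $(c,c+1)$ involving $\varphi$ and $\partial_3\varphi$
(`eq_integral_slice`); the same integral makes sense for $f\in H^1_{loc}$ and depends continuously
on it, so it is the trace. -/

namespace LawrenceDoniach

/-! ### Weak partial derivatives -/

lemma continuous_partialD {φ : E3 → ℝ} (hφ : ContDiff ℝ ∞ φ) (j : Fin 3) :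
    Continuous (partialD j φ) :=
  (hφ.continuous_fderiv (by simp)).clm_apply continuous_const

lemma IsTestFunction.hasCompactSupport_partialD {φ : E3 → ℝ} (hφ : IsTestFunction φ)
    (j : Fin 3) : HasCompactSupport (partialD j φ) :=
  hφ.2.fderiv_apply (𝕜 := ℝ) _

lemma integrable_mul_test {f : E3 → ℝ} (hf : LocallyIntegrable f) {φ : E3 → ℝ}
    (hφ : Continuous φ) (hc : HasCompactSupport φ) : Integrable (fun x => f x * φ x) := by
  simpa [mul_comm] using hf.integrable_smul_left_of_hasCompactSupport hφ hc

/-- The fundamental lemma of the calculus of variations. Since `weakPartial` is an arbitrary choice,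
this is what lets it be computed, almost everywhere. -/
lemma HasWeakPartial.ae_eq {j : Fin 3} {f g g' : E3 → ℝ} (h : HasWeakPartial j f g)
    (h' : HasWeakPartial j f g') : g =ᵐ[volume] g' := by
  have key : ∀ᵐ x, (g - g') x = 0 := by
    refine ae_eq_zero_of_integral_contDiff_smul_eq_zero (h.2.1.sub h'.2.1) fun φ hφ hc => ?_
    have h1 := h.2.2 φ ⟨hφ, hc⟩
    have h2 := h'.2.2 φ ⟨hφ, hc⟩
    have : ∫ x, φ x • (g - g') x = (∫ x, g x * φ x) - ∫ x, g' x * φ x := by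
      rw [← integral_sub (integrable_mul_test h.2.1 hφ.continuous hc)
        (integrable_mul_test h'.2.1 hφ.continuous hc)]
      congr 1 with x
      simp only [Pi.sub_apply, smul_eq_mul]; ring
    rw [this]; linarith
  filter_upwards [key] with x hx
  exact sub_eq_zero.1 hx

lemma hasWeakPartial_weakPartial {j : Fin 3} {f : E3 → ℝ} (h : ∃ g, HasWeakPartial j f g) :
    HasWeakPartial j f (weakPartial j f) := by
  rw [weakPartial, dif_pos h]
  exact h.choose_spec

lemma HasWeakPartial.weakPartial_ae_eq {j : Fin 3} {f g : E3 → ℝ} (h : HasWeakPartial j f g) :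
    weakPartial j f =ᵐ[volume] g :=
  (hasWeakPartial_weakPartial ⟨g, h⟩).ae_eq h

lemma hasWeakPartial_of_contDiff {f : E3 → ℝ} (hf : ContDiff ℝ ∞ f) (j : Fin 3) :
    HasWeakPartial j f (partialD j f) := by
  refine ⟨hf.continuous.locallyIntegrable,
    (continuous_partialD hf j).locallyIntegrable, fun φ hφ => ?_⟩
  have hd := (continuous_partialD hf j).locallyIntegrable (μ := volume)
  have hf' := hf.continuous.locallyIntegrable (μ := (volume : Measure E3))
  exact integral_mul_fderiv_eq_neg_fderiv_mul_of_integrable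
    (integrable_mul_test hd hφ.1.continuous hφ.2)
    (integrable_mul_test hf' (continuous_partialD hφ.1 j)
      (hφ.hasCompactSupport_partialD j))
    (integrable_mul_test hf' hφ.1.continuous hφ.2)
    (fun x _ => hf.differentiable (by simp) x) (fun x _ => hφ.1.differentiable (by simp) x)

lemma HasWeakPartial.linear_comb {j : Fin 3} {f g f' g' : E3 → ℝ} (h : HasWeakPartial j f g)
    (h' : HasWeakPartial j f' g') (a b : ℝ) :
    HasWeakPartial j (fun x => a * f x + b * f' x) (fun x => a * g x + b * g' x) := by
  refine ⟨(h.1.smul a).add (h'.1.smul b), (h.2.1.smul a).add (h'.2.1.smul b), fun φ hφ => ?_⟩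
  have hd := continuous_partialD hφ.1 j
  have hdc := hφ.hasCompactSupport_partialD j
  have e1 : ∀ u u' ψ : E3 → ℝ, Integrable (fun x => u x * ψ x) → Integrable (fun x => u' x * ψ x) →
      ∫ x, (a * u x + b * u' x) * ψ x = a * (∫ x, u x * ψ x) + b * ∫ x, u' x * ψ x := by
    intro u u' ψ hu hu'
    rw [← integral_const_mul, ← integral_const_mul,
      ← integral_add (hu.const_mul a) (hu'.const_mul b)]
    congr 1 with x; ring
  rw [e1 _ _ _ (integrable_mul_test h.1 hd hdc) (integrable_mul_test h'.1 hd hdc),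
    e1 _ _ _ (integrable_mul_test h.2.1 hφ.1.continuous hφ.2)
      (integrable_mul_test h'.2.1 hφ.1.continuous hφ.2), h.2.2 φ hφ, h'.2.2 φ hφ]
  ring

lemma memL2loc_of_continuous {X : Type*} [TopologicalSpace X] [MeasureSpace X]
    [OpensMeasurableSpace X] [T2Space X] [SecondCountableTopology X]
    [IsFiniteMeasureOnCompacts (volume : Measure X)]
    {f : X → ℝ} (hf : Continuous f) : MemL2loc f := by
  intro K hK
  obtain ⟨C, hC⟩ := hK.exists_bound_of_continuousOn hf.continuousOn
  have : IsFiniteMeasure (volume.restrict K) := ⟨by simpa using hK.measure_lt_top⟩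
  exact MemLp.of_bound hf.aestronglyMeasurable C
    ((ae_restrict_mem hK.measurableSet).mono fun x hx => hC x hx)

lemma MemH1loc.linear_comb_contDiff {f u : E3 → ℝ} (hf : MemH1loc f) (hu : ContDiff ℝ ∞ u)
    (a b : ℝ) : MemH1loc (fun x => a * f x + b * u x) := by
  refine ⟨fun K hK => ((hf.1 K hK).const_mul a).add
    ((memL2loc_of_continuous hu.continuous K hK).const_mul b), fun j => ?_⟩
  have h := (hasWeakPartial_weakPartial (hf.2 j).1).linear_comb
    (hasWeakPartial_of_contDiff hu j) a b
  refine ⟨⟨_, h⟩, fun K hK => ?_⟩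
  refine MemLp.ae_eq (EventuallyEq.symm (ae_restrict_of_ae h.weakPartial_ae_eq)) ?_
  exact (((hf.2 j).2 K hK).const_mul a).add
    ((memL2loc_of_continuous (continuous_partialD hu j) K hK).const_mul b)

/-! ### `L²` seminorms and the Cauchy–Schwarz inequality -/

lemma eLpNorm_two_sq {α F : Type*} [MeasurableSpace α] [NormedAddCommGroup F] (μ : Measure α)
    (f : α → F) : eLpNorm f 2 μ ^ 2 = ∫⁻ x, ‖f x‖ₑ ^ 2 ∂μ := by
  have := eLpNorm_nnreal_pow_eq_lintegral (μ := μ) (f := f) (p := 2) two_ne_zero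
  simpa using this

lemma eLpNorm_two_le_iff {α β F G : Type*} [MeasurableSpace α] [MeasurableSpace β]
    [NormedAddCommGroup F] [NormedAddCommGroup G] {μ : Measure α} {ν : Measure β}
    {f : α → F} {g : β → G} :
    eLpNorm f 2 μ ≤ eLpNorm g 2 ν ↔ ∫⁻ x, ‖f x‖ₑ ^ 2 ∂μ ≤ ∫⁻ x, ‖g x‖ₑ ^ 2 ∂ν := by
  rw [← eLpNorm_two_sq, ← eLpNorm_two_sq, ENNReal.pow_le_pow_left_iff two_ne_zero]

/-- Cauchy–Schwarz against the constant 1. It serves as Jensen's inequality for the mollifier and as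
the length bound on vertical segments. -/
lemma sq_lintegral_le {α : Type*} [MeasurableSpace α] (μ : Measure α) {F : α → ℝ≥0∞}
    (hF : AEMeasurable F μ) : (∫⁻ x, F x ∂μ) ^ 2 ≤ μ univ * ∫⁻ x, F x ^ 2 ∂μ := by
  have h := ENNReal.lintegral_mul_le_Lp_mul_Lq μ Real.HolderConjugate.two_two hF
    (g := fun _ => 1) aemeasurable_const
  simp only [Pi.mul_apply, mul_one, ENNReal.one_rpow, lintegral_one] at h
  calc (∫⁻ x, F x ∂μ) ^ 2
      ≤ ((∫⁻ x, F x ^ (2 : ℝ) ∂μ) ^ (1 / 2 : ℝ) * μ univ ^ (1 / 2 : ℝ)) ^ 2 := by gcongr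
    _ = μ univ * ∫⁻ x, F x ^ 2 ∂μ := by
      rw [mul_pow, ← ENNReal.rpow_natCast, ← ENNReal.rpow_natCast, ← ENNReal.rpow_mul,
        ← ENNReal.rpow_mul]
      norm_num [mul_comm]

/-! ### Mollification -/

/-- The mollification of `f` by a normalized bump function. -/
noncomputable def mollify (η : ContDiffBump (0 : E3)) (f : E3 → ℝ) : E3 → ℝ :=
  convolution (η.normed volume) f (ContinuousLinearMap.lsmul ℝ ℝ) volume

lemma mollify_apply (η : ContDiffBump (0 : E3)) (f : E3 → ℝ) (x : E3) :
    mollify η f x = ∫ t, η.normed volume t * f (x - t) := rfl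

lemma mollify_congr (η : ContDiffBump (0 : E3)) {f g : E3 → ℝ} (h : f =ᵐ[volume] g) :
    mollify η f = mollify η g :=
  convolution_congr _ (ae_eq_refl _) h

lemma contDiff_mollify (η : ContDiffBump (0 : E3)) {f : E3 → ℝ} (hf : LocallyIntegrable f) :
    ContDiff ℝ ∞ (mollify η f) :=
  η.hasCompactSupport_normed.contDiff_convolution_left _ η.contDiff_normed hf

lemma mollify_sub (η : ContDiffBump (0 : E3)) {f g : E3 → ℝ} (hf : LocallyIntegrable f)
    (hg : LocallyIntegrable g) : mollify η (f - g) = mollify η f - mollify η g := by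
  have ex : ∀ {u : E3 → ℝ}, LocallyIntegrable u → ∀ x,
      Integrable (fun t => η.normed volume t * u (x - t)) := fun hu x =>
    η.hasCompactSupport_normed.convolutionExists_left (ContinuousLinearMap.lsmul ℝ ℝ)
      η.continuous_normed hu x
  ext x
  simp only [mollify_apply, Pi.sub_apply]
  rw [← integral_sub (ex hf x) (ex hg x)]
  congr 1 with t; ring

lemma partialD_mollify (η : ContDiffBump (0 : E3)) {j : Fin 3} {f g : E3 → ℝ}
    (h : HasWeakPartial j f g) : partialD j (mollify η f) = mollify η g := by
  ext x
  have hη : ContDiff ℝ ∞ (η.normed (volume : Measure E3)) := η.contDiff_normed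
  have hd := η.hasCompactSupport_normed.hasFDerivAt_convolution_left
    (ContinuousLinearMap.lsmul ℝ ℝ) (hη.of_le (by simp)) h.1 x
  have hint : Integrable (fun t => (ContinuousLinearMap.precompL E3
      (ContinuousLinearMap.lsmul ℝ ℝ : ℝ →L[ℝ] ℝ →L[ℝ] ℝ))
        (fderiv ℝ (η.normed (volume : Measure E3)) t) (f (x - t))) :=
    (η.hasCompactSupport_normed.fderiv (𝕜 := ℝ)).convolutionExists_left _
      (hη.continuous_fderiv (by simp)) h.1 x
  have e1 : partialD j (mollify η f) x = ∫ t, partialD j (η.normed volume) t * f (x - t) := by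
    rw [partialD, mollify, hd.fderiv, convolution_def, ContinuousLinearMap.integral_apply hint]
    simp [partialD, ContinuousLinearMap.precompL_apply]
  -- Test the weak derivative with the reflected, translated bump; reflection changes the sign of
  -- its derivative, which cancels the sign of the integration by parts.
  set ψ : E3 → ℝ := fun y => η.normed volume (x - y) with hψ
  have hψt : IsTestFunction ψ := by
    refine ⟨hη.comp (contDiff_const.sub contDiff_id), ?_⟩
    exact η.hasCompactSupport_normed.comp_homeomorph (Homeomorph.subLeft x)
  have hψd : ∀ y, partialD j ψ y = - partialD j (η.normed volume) (x - y) := by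
    intro y
    have h1 : HasFDerivAt (fun y : E3 => x - y) (-ContinuousLinearMap.id ℝ E3) y :=
      (hasFDerivAt_id y).const_sub x
    have h2 := ((hη.differentiable (by simp) (x - y)).hasFDerivAt).comp y h1
    have h3 : fderiv ℝ ψ y = _ := h2.fderiv
    simp [partialD, h3]
  have key := h.2.2 ψ hψt
  rw [e1, mollify_apply,
    ← integral_sub_left_eq_self (fun t => partialD j (η.normed volume) t * f (x - t)) volume x,
    ← integral_sub_left_eq_self (fun t => η.normed volume t * g (x - t)) volume x]
  simp only [hψd, mul_neg, integral_neg, neg_inj] at key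
  simpa only [sub_sub_cancel, mul_comm, hψ] using key

lemma lintegral_bump (η : ContDiffBump (0 : E3)) :
    ∫⁻ t, ENNReal.ofReal (η.normed volume t) = 1 := by
  rw [← ofReal_integral_eq_lintegral_ofReal η.integrable_normed
    (ae_of_all _ η.nonneg_normed), η.integral_normed, ENNReal.ofReal_one]

/-- Jensen's inequality for the probability measure whose density is the bump. -/
lemma enorm_mollify_sq_le (η : ContDiffBump (0 : E3)) {f : E3 → ℝ} (hf : Measurable f) (x : E3) :
    ‖mollify η f x‖ₑ ^ 2 ≤ ∫⁻ t, ENNReal.ofReal (η.normed volume t) * ‖f (x - t)‖ₑ ^ 2 := by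
  have hm : Measurable fun t => ENNReal.ofReal (η.normed (volume : Measure E3) t) :=
    η.continuous_normed.measurable.ennreal_ofReal
  set ν := (volume : Measure E3).withDensity fun t => ENNReal.ofReal (η.normed volume t) with hν
  have hu : ν univ = 1 := by
    rw [hν, withDensity_apply _ MeasurableSet.univ, Measure.restrict_univ, lintegral_bump]
  have hF : Measurable fun t => ‖f (x - t)‖ₑ := by fun_prop
  calc ‖mollify η f x‖ₑ ^ 2 ≤ (∫⁻ t, ‖f (x - t)‖ₑ ∂ν) ^ 2 := by
        gcongr
        rw [hν, lintegral_withDensity_eq_lintegral_mul _ hm hF, mollify_apply]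
        refine (enorm_integral_le_lintegral_enorm _).trans_eq (lintegral_congr fun t => ?_)
        rw [enorm_mul, Real.enorm_of_nonneg (η.nonneg_normed t)]; rfl
    _ ≤ ν univ * ∫⁻ t, ‖f (x - t)‖ₑ ^ 2 ∂ν := sq_lintegral_le _ hF.aemeasurable
    _ = _ := by
        rw [hu, one_mul, hν, lintegral_withDensity_eq_lintegral_mul _ hm (hF.pow_const 2)]; rfl

/-- Tonelli and translation invariance: a shift by a vector of the bump's support, of length less
than 1, keeps the ball of radius $R$ inside that of radius $R+1$. -/
lemma eLpNorm_mollify_le (η : ContDiffBump (0 : E3)) (hη : η.rOut ≤ 1) {f : E3 → ℝ}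
    (hf : AEStronglyMeasurable f) (R : ℝ) :
    eLpNorm (mollify η f) 2 (volume.restrict (Metric.closedBall 0 R))
      ≤ eLpNorm f 2 (volume.restrict (Metric.closedBall 0 (R + 1))) := by
  wlog hm : Measurable f generalizing f
  · have := this hf.stronglyMeasurable_mk.aestronglyMeasurable hf.stronglyMeasurable_mk.measurable
    rwa [mollify_congr η hf.ae_eq_mk, eLpNorm_congr_ae (ae_restrict_of_ae hf.ae_eq_mk)]
  have hηm : Measurable fun t => ENNReal.ofReal (η.normed (volume : Measure E3) t) :=
    η.continuous_normed.measurable.ennreal_ofReal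
  rw [eLpNorm_two_le_iff]
  set B := Metric.closedBall (0 : E3) R with hB
  set B' := Metric.closedBall (0 : E3) (R + 1) with hB'
  have hBm : MeasurableSet B := Metric.isClosed_closedBall.measurableSet
  have hBm' : MeasurableSet B' := Metric.isClosed_closedBall.measurableSet
  calc ∫⁻ x in B, ‖mollify η f x‖ₑ ^ 2
      ≤ ∫⁻ x in B, ∫⁻ t, ENNReal.ofReal (η.normed volume t) * ‖f (x - t)‖ₑ ^ 2 :=
        lintegral_mono fun x => enorm_mollify_sq_le η hm x
    _ = ∫⁻ t, ∫⁻ x in B, ENNReal.ofReal (η.normed volume t) * ‖f (x - t)‖ₑ ^ 2 := by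
        refine lintegral_lintegral_swap (Measurable.aemeasurable ?_)
        exact (hηm.comp measurable_snd).mul ((hm.comp measurable_sub).enorm.pow_const 2)
    _ ≤ ∫⁻ t, ENNReal.ofReal (η.normed volume t) * ∫⁻ x in B', ‖f x‖ₑ ^ 2 := by
        refine lintegral_mono fun t => ?_
        rw [lintegral_const_mul _ (by fun_prop)]
        by_cases ht : t ∈ Metric.ball (0 : E3) η.rOut
        · refine mul_le_mul_right ?_ _
          rw [← lintegral_indicator hBm, ← lintegral_indicator hBm',
            ← lintegral_sub_right_eq_self (B'.indicator fun x => ‖f x‖ₑ ^ 2) t]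
          refine lintegral_mono fun x => ?_
          by_cases hx : x ∈ B
          · have : x - t ∈ B' := by
              simp only [hB, hB', Metric.mem_closedBall, Metric.mem_ball, dist_zero_right] at *
              linarith [norm_sub_le x t]
            rw [indicator_of_mem hx, indicator_of_mem this]
          · rw [indicator_of_notMem hx]; exact zero_le
        · have : η.normed volume t = 0 := by
            rwa [← Function.notMem_support, η.support_normed_eq]
          simp [this]
    _ = ∫⁻ x in B', ‖f x‖ₑ ^ 2 := by
        rw [lintegral_mul_const _ hηm, lintegral_bump, one_mul]

lemma tendsto_eLpNorm_mollify_sub {η : ℕ → ContDiffBump (0 : E3)}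
    (hη : Tendsto (fun k => (η k).rOut) atTop (𝓝 0)) {f : E3 → ℝ} (hf : LocallyIntegrable f)
    (hf2 : MemL2loc f) {K : Set E3} (hK : IsCompact K) :
    Tendsto (fun k => eLpNorm (fun x => mollify (η k) f x - f x) 2 (volume.restrict K))
      atTop (𝓝 0) := by
  obtain ⟨R, hR⟩ := hK.isBounded.subset_closedBall 0
  set B := Metric.closedBall (0 : E3) R with hB
  set B' := Metric.closedBall (0 : E3) (R + 1) with hB'
  have hBB' : B ⊆ B' := Metric.closedBall_subset_closedBall (by linarith)
  have hBm' : MeasurableSet B' := Metric.isClosed_closedBall.measurableSet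
  have hfm := hf.aestronglyMeasurable
  rw [ENNReal.tendsto_nhds_zero]
  intro ε hε
  have hδ : ε / 3 ≠ 0 := by simp [hε.ne']
  -- Cut off to the larger ball, $f$ is globally in $L^2$ and has a continuous compactly supported
  -- approximation $g$; mollifying $f-g$ costs no more than $f-g$ itself, and $g$ is uniformly
  -- continuous.
  have hfB : MemLp (B'.indicator f) 2 volume :=
    (memLp_indicator_iff_restrict hBm').2 (hf2 B' (isCompact_closedBall _ _))
  obtain ⟨g, hgc, hgle, hgcont, -⟩ := hfB.exists_hasCompactSupport_eLpNorm_sub_le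
    (by simp) hδ
  have hfg : eLpNorm (f - g) 2 (volume.restrict B') ≤ ε / 3 := by
    refine le_trans (le_of_eq ?_) ((eLpNorm_mono_measure _
      (Measure.restrict_le_self (s := B'))).trans hgle)
    refine eLpNorm_congr_ae ?_
    filter_upwards [ae_restrict_mem hBm'] with x hx
    simp [indicator_of_mem hx]
  -- $C$ is a uniform error so small that $C\,|B|^{1/2}<\varepsilon/3$.
  obtain ⟨C, hC0, hC⟩ := ENNReal.exists_nnreal_pos_mul_lt
    (a := volume.restrict B univ ^ (2 : ℝ≥0∞).toReal⁻¹) (b := ε / 3)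
    (ENNReal.rpow_ne_top_of_nonneg (by simp)
      (by simpa using (isCompact_closedBall (0 : E3) R).measure_lt_top.ne)) hδ
  obtain ⟨δ, hδ0, hδg⟩ := Metric.uniformContinuous_iff.1
    (hgc.uniformContinuous_of_continuous hgcont) C (by exact_mod_cast hC0)
  filter_upwards [hη.eventually (gt_mem_nhds hδ0), hη.eventually (gt_mem_nhds one_pos)]
    with k hk1 hk2
  have hgl : LocallyIntegrable g := hgcont.locallyIntegrable
  have hsplit : (fun x => mollify (η k) f x - f x)
      = mollify (η k) (f - g) + ((g - f) + (mollify (η k) g - g)) := by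
    rw [mollify_sub _ hf hgl]; ext x
    simp only [Pi.add_apply, Pi.sub_apply]; ring
  have hmf := (contDiff_mollify (η k) (hf.sub hgl)).continuous.aestronglyMeasurable
    (μ := volume.restrict B)
  have hmg := (contDiff_mollify (η k) hgl).continuous.aestronglyMeasurable
    (μ := volume.restrict B)
  have hgm := hgcont.aestronglyMeasurable (μ := volume.restrict B)
  have h3 : eLpNorm (mollify (η k) g - g) 2 (volume.restrict B) ≤ ε / 3 := by
    refine (eLpNorm_le_of_ae_bound (C := C) (ae_of_all _ fun x => ?_)).trans ?_
    · rw [Pi.sub_apply, ← dist_eq_norm]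
      refine (η k).dist_normed_convolution_le hgcont.aestronglyMeasurable fun y hy => ?_
      exact (hδg ((Metric.mem_ball.1 hy).trans hk1)).le
    · rw [mul_comm, ENNReal.ofReal_coe_nnreal]
      exact hC.le
  have h2 : eLpNorm (g - f) 2 (volume.restrict B) ≤ ε / 3 := by
    rw [← neg_sub, eLpNorm_neg]
    exact (eLpNorm_mono_measure _ (Measure.restrict_mono hBB' le_rfl)).trans hfg
  calc eLpNorm (fun x => mollify (η k) f x - f x) 2 (volume.restrict K)
      ≤ eLpNorm (fun x => mollify (η k) f x - f x) 2 (volume.restrict B) :=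
        eLpNorm_mono_measure _ (Measure.restrict_mono hR le_rfl)
    _ ≤ eLpNorm (mollify (η k) (f - g)) 2 (volume.restrict B)
        + (eLpNorm (g - f) 2 (volume.restrict B)
          + eLpNorm (mollify (η k) g - g) 2 (volume.restrict B)) := by
        rw [hsplit]
        refine (eLpNorm_add_le hmf ((hgm.sub hfm.restrict).add (hmg.sub hgm))
          one_le_two).trans ?_
        gcongr
        exact eLpNorm_add_le (hgm.sub hfm.restrict) (hmg.sub hgm) one_le_two
    _ ≤ ε / 3 + (ε / 3 + ε / 3) := by
        gcongr
        exact (eLpNorm_mollify_le (η k) hk2.le (hfm.sub hgl.aestronglyMeasurable) R).trans hfg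
    _ = ε := by rw [← add_assoc, ENNReal.add_thirds]

lemma tendstoUniformlyOn_mollify {η : ℕ → ContDiffBump (0 : E3)}
    (hη : Tendsto (fun k => (η k).rOut) atTop (𝓝 0)) {f : E3 → ℝ} (hf : Continuous f)
    {K : Set E3} (hK : IsCompact K) :
    TendstoUniformlyOn (fun k => mollify (η k) f) f atTop K := by
  have hu : UniformContinuousOn f (Metric.cthickening 1 K) :=
    hK.cthickening.uniformContinuousOn_of_continuous hf.continuousOn
  rw [Metric.tendstoUniformlyOn_iff]
  intro ε hε
  obtain ⟨δ, hδ0, hδ⟩ := Metric.uniformContinuousOn_iff.1 hu (ε / 2) (half_pos hε)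
  filter_upwards [hη.eventually (gt_mem_nhds hδ0), hη.eventually (gt_mem_nhds one_pos)]
    with k hk1 hk2 x hx
  rw [dist_comm]
  refine lt_of_le_of_lt ?_ (half_lt_self hε)
  refine (η k).dist_normed_convolution_le hf.aestronglyMeasurable fun y hy => ?_
  have hy' := Metric.mem_ball.1 hy
  exact (hδ y (Metric.mem_cthickening_of_dist_le y x 1 K hx (hy'.trans hk2).le) x
    (Metric.self_subset_cthickening K hx) (hy'.trans hk1)).le

/-- A sequence of bump functions whose supports shrink to the origin. -/
noncomputable def shrinkingBump (k : ℕ) : ContDiffBump (0 : E3) where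
  rIn := 1 / (k + 2)
  rOut := 1 / (k + 1)
  rIn_pos := by positivity
  rIn_lt_rOut := by gcongr; norm_num

lemma tendsto_shrinkingBump : Tendsto (fun k => (shrinkingBump k).rOut) atTop (𝓝 0) :=
  tendsto_one_div_add_atTop_nhds_zero_nat

/-! ### Slicing `ℝ³` by horizontal planes -/

@[simp] lemma hat_apply_zero (x : E3) : hat x 0 = x 0 := rfl
@[simp] lemma hat_apply_one (x : E3) : hat x 1 = x 1 := rfl
@[simp] lemma atHeight_apply_zero (y : E2) (c : ℝ) : atHeight y c 0 = y 0 := rfl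
@[simp] lemma atHeight_apply_one (y : E2) (c : ℝ) : atHeight y c 1 = y 1 := rfl
@[simp] lemma atHeight_apply_two (y : E2) (c : ℝ) : atHeight y c 2 = c := rfl

@[simp] lemma hat_atHeight (y : E2) (c : ℝ) : hat (atHeight y c) = y := by
  ext i; fin_cases i <;> rfl

@[simp] lemma atHeight_hat (x : E3) : atHeight (hat x) (x 2) = x := by
  ext i; fin_cases i <;> rfl

lemma continuous_hat : Continuous hat := by
  refine (PiLp.continuous_toLp 2 _).comp (continuous_pi fun i => ?_)
  fin_cases i <;> simp <;> fun_prop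

lemma continuous_atHeight : Continuous fun p : E2 × ℝ => atHeight p.1 p.2 := by
  refine (PiLp.continuous_toLp 2 _).comp (continuous_pi fun i => ?_)
  fin_cases i <;> simp <;> fun_prop

/-- The splitting of `ℝ³` into horizontal part and height. -/
def sliceEquiv : E3 ≃ᵐ E2 × ℝ where
  toFun x := (hat x, x 2)
  invFun p := atHeight p.1 p.2
  left_inv := atHeight_hat
  right_inv p := by simp
  measurable_toFun := by
    refine Measurable.prodMk continuous_hat.measurable ?_
    exact Continuous.measurable (by fun_prop)
  measurable_invFun := continuous_atHeight.measurable

lemma measurePreserving_sliceEquiv :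
    MeasurePreserving sliceEquiv volume ((volume : Measure E2).prod (volume : Measure ℝ)) := by
  have h1 := PiLp.volume_preserving_ofLp (Fin 3)
  have h2 := volume_preserving_piFinSuccAbove (fun _ : Fin 3 => ℝ) 2
  have h3 : MeasurePreserving (Prod.swap : ℝ × (Fin 2 → ℝ) → (Fin 2 → ℝ) × ℝ)
      volume (volume.prod volume) := Measure.measurePreserving_swap
  have h4 := (PiLp.volume_preserving_toLp (Fin 2)).prod
    (MeasurePreserving.id (volume : Measure ℝ))
  have h := h4.comp (h3.comp (h2.comp h1))
  have e : ⇑sliceEquiv = Prod.map (WithLp.toLp 2) id ∘ Prod.swap ∘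
      MeasurableEquiv.piFinSuccAbove (fun _ : Fin 3 => ℝ) 2 ∘ WithLp.ofLp := by
    funext x
    refine Prod.ext ?_ rfl
    ext i
    fin_cases i <;> rfl
  rw [e]
  exact h

/-- The part of `ℝ³` with horizontal part in `S` and height in `I`. -/
def slab (S : Set E2) (I : Set ℝ) : Set E3 := {x | hat x ∈ S ∧ x 2 ∈ I}

lemma slab_eq_preimage (S : Set E2) (I : Set ℝ) : slab S I = sliceEquiv ⁻¹' (S ×ˢ I) := rfl

lemma measurableSet_slab {S : Set E2} {I : Set ℝ} (hS : MeasurableSet S) (hI : MeasurableSet I) :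
    MeasurableSet (slab S I) :=
  sliceEquiv.measurable (hS.prod hI)

lemma isCompact_slab {S : Set E2} {I : Set ℝ} (hS : IsCompact S) (hI : IsCompact I) :
    IsCompact (slab S I) := by
  have : slab S I = (fun p : E2 × ℝ => atHeight p.1 p.2) '' (S ×ˢ I) := by
    ext x
    constructor
    · exact fun hx => ⟨(hat x, x 2), hx, atHeight_hat x⟩
    · rintro ⟨p, hp, rfl⟩
      simpa [slab] using hp
  rw [this]
  exact (hS.prod hI).image continuous_atHeight

lemma slab_mono {S S' : Set E2} {I I' : Set ℝ} (hS : S ⊆ S') (hI : I ⊆ I') :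
    slab S I ⊆ slab S' I' := fun _ hx => ⟨hS hx.1, hI hx.2⟩

lemma measurePreserving_sliceEquiv_restrict {S : Set E2} {I : Set ℝ} :
    MeasurePreserving sliceEquiv (volume.restrict (slab S I))
      ((volume.restrict S).prod (volume.restrict I)) := by
  rw [Measure.prod_restrict, slab_eq_preimage]
  exact measurePreserving_sliceEquiv.restrict_preimage_emb sliceEquiv.measurableEmbedding _

lemma measurePreserving_atHeight_restrict {S : Set E2} {I : Set ℝ} :
    MeasurePreserving (fun p : E2 × ℝ => atHeight p.1 p.2)
      ((volume.restrict S).prod (volume.restrict I)) (volume.restrict (slab S I)) :=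
  measurePreserving_sliceEquiv_restrict.symm sliceEquiv

lemma lintegral_slab {S : Set E2} {I : Set ℝ} {F : E3 → ℝ≥0∞}
    (hF : AEMeasurable F (volume.restrict (slab S I))) :
    ∫⁻ x in slab S I, F x = ∫⁻ y in S, ∫⁻ t in I, F (atHeight y t) := by
  have hmp := measurePreserving_atHeight_restrict (S := S) (I := I)
  have hF' : AEMeasurable (fun p : E2 × ℝ => F (atHeight p.1 p.2))
      ((volume.restrict S).prod (volume.restrict I)) :=
    hF.comp_quasiMeasurePreserving hmp.quasiMeasurePreserving
  rw [← lintegral_prod _ hF',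
    ← hmp.lintegral_comp_emb sliceEquiv.symm.measurableEmbedding]

lemma aestronglyMeasurable_comp_hat {F : Type*} [TopologicalSpace F] {S : Set E2} {I : Set ℝ}
    {w : E2 → F} (hw : AEStronglyMeasurable w (volume.restrict S)) :
    AEStronglyMeasurable (fun x => w (hat x)) (volume.restrict (slab S I)) :=
  hw.comp_quasiMeasurePreserving
    (Measure.quasiMeasurePreserving_fst.comp
      (measurePreserving_sliceEquiv_restrict (S := S) (I := I)).quasiMeasurePreserving)

/-- Fubini for a function constant along vertical segments; squaring avoids a square root of the
length of $I$. -/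
lemma eLpNorm_comp_hat_sq {S : Set E2} {I : Set ℝ} {w : E2 → ℝ}
    (hw : AEStronglyMeasurable w (volume.restrict S)) :
    eLpNorm (fun x => w (hat x)) 2 (volume.restrict (slab S I)) ^ 2
      = volume I * eLpNorm w 2 (volume.restrict S) ^ 2 := by
  rw [eLpNorm_two_sq, eLpNorm_two_sq,
    lintegral_slab ((aestronglyMeasurable_comp_hat hw).enorm.pow_const 2)]
  simp only [hat_atHeight, lintegral_const, Measure.restrict_apply_univ]
  rw [lintegral_mul_const'' _ (hw.enorm.pow_const 2), mul_comm]

lemma memLp_comp_hat {S : Set E2} {I : Set ℝ} (hI : volume I ≠ ⊤) {w : E2 → ℝ}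
    (hw : MemLp w 2 (volume.restrict S)) :
    MemLp (fun x => w (hat x)) 2 (volume.restrict (slab S I)) := by
  refine ⟨aestronglyMeasurable_comp_hat hw.1, ?_⟩
  refine (ENNReal.pow_lt_top_iff.1 (?_ : _ ^ 2 < ⊤)).resolve_right two_ne_zero
  rw [eLpNorm_comp_hat_sq hw.1]
  exact ENNReal.mul_lt_top hI.lt_top (ENNReal.pow_lt_top hw.2)

/-- Cauchy–Schwarz on each vertical segment, the length being absorbed by $|I|\le1$. Vertical
integration is thus $L^2$-bounded, which gives the continuity of traces. -/
lemma eLpNorm_integral_slice_le {S : Set E2} {I : Set ℝ} (hI : volume I ≤ 1) {u : E3 → ℝ}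
    (hu : AEStronglyMeasurable u (volume.restrict (slab S I))) :
    eLpNorm (fun y => ∫ t in I, u (atHeight y t)) 2 (volume.restrict S)
      ≤ eLpNorm u 2 (volume.restrict (slab S I)) := by
  have hmp := measurePreserving_atHeight_restrict (S := S) (I := I)
  have hu' := hu.comp_quasiMeasurePreserving hmp.quasiMeasurePreserving
  rw [eLpNorm_two_le_iff, lintegral_slab (hu.enorm.pow_const 2)]
  refine lintegral_mono_ae ?_
  filter_upwards [hu'.prodMk_left] with y hy
  calc ‖∫ t in I, u (atHeight y t)‖ₑ ^ 2 ≤ (∫⁻ t in I, ‖u (atHeight y t)‖ₑ) ^ 2 := by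
        gcongr; exact enorm_integral_le_lintegral_enorm _
    _ ≤ volume.restrict I univ * ∫⁻ t in I, ‖u (atHeight y t)‖ₑ ^ 2 := sq_lintegral_le _ hy.enorm
    _ ≤ ∫⁻ t in I, ‖u (atHeight y t)‖ₑ ^ 2 := by
        rw [Measure.restrict_apply_univ]
        exact mul_le_of_le_one_left' hI

/-! ### Smooth functions along vertical segments. -/

lemma hasDerivAt_atHeight (y : E2) (t : ℝ) :
    HasDerivAt (fun t => atHeight y t) (EuclideanSpace.single 2 1) t := by
  have e : (fun t => atHeight y t)
      = fun t => atHeight y 0 + t • EuclideanSpace.single (2 : Fin 3) (1 : ℝ) := by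
    funext t
    ext i
    fin_cases i <;> simp
  rw [e]
  simpa using ((hasDerivAt_id t).smul_const (EuclideanSpace.single (2 : Fin 3) (1 : ℝ))).const_add
    (atHeight y 0)

lemma hasDerivAt_comp_atHeight {φ : E3 → ℝ} (hφ : ContDiff ℝ ∞ φ) (y : E2) (t : ℝ) :
    HasDerivAt (fun t => φ (atHeight y t)) (partialD 2 φ (atHeight y t)) t :=
  (hφ.differentiable (by simp) _).hasFDerivAt.comp_hasDerivAt t (hasDerivAt_atHeight y t)

lemma continuous_atHeight_right (y : E2) : Continuous fun t => atHeight y t :=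
  continuous_atHeight.comp (continuous_const.prodMk continuous_id)

lemma continuous_atHeight_left (c : ℝ) : Continuous fun y => atHeight y c :=
  continuous_atHeight.comp (continuous_id.prodMk continuous_const)

/-- The thin-layer estimate for smooth functions. The two inclusions leave the endpoints of $I$
free, so that open and half-open layers are treated alike. -/
lemma eLpNorm_sub_slice_le {φ : E3 → ℝ} (hφ : ContDiff ℝ ∞ φ) (S : Set E2) {I : Set ℝ}
    {c s : ℝ} (hIm : MeasurableSet I) (hI : I ⊆ Icc c (c + s))
    (hI' : Ioo c (c + s) ⊆ I) :
    eLpNorm (fun x => φ x - φ (atHeight (hat x) c)) 2 (volume.restrict (slab S I))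
      ≤ ENNReal.ofReal s * eLpNorm (partialD 2 φ) 2 (volume.restrict (slab S I)) := by
  have hd := continuous_partialD hφ 2
  have hvol : volume I ≤ ENNReal.ofReal s := by
    simpa using measure_mono (μ := volume) hI
  have hcont : Continuous fun x => φ x - φ (atHeight (hat x) c) :=
    hφ.continuous.sub (hφ.continuous.comp
      (continuous_atHeight.comp (continuous_hat.prodMk continuous_const)))
  rw [← ENNReal.pow_le_pow_left_iff two_ne_zero, mul_pow, eLpNorm_two_sq, eLpNorm_two_sq,
    lintegral_slab (hcont.measurable.enorm.pow_const 2).aemeasurable,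
    lintegral_slab (hd.measurable.enorm.pow_const 2).aemeasurable,
    ← lintegral_const_mul' _ _ (by simp)]
  refine lintegral_mono fun y => ?_
  have hdy : Continuous fun t => partialD 2 φ (atHeight y t) := hd.comp (continuous_atHeight_right y)
  have hpt : ∀ t ∈ I, ‖φ (atHeight y t) - φ (atHeight (hat (atHeight y t)) c)‖ₑ ^ 2
      ≤ ENNReal.ofReal s * ∫⁻ t in I, ‖partialD 2 φ (atHeight y t)‖ₑ ^ 2 := by
    intro t ht
    have htc := hI ht
    rw [hat_atHeight, ← intervalIntegral.integral_eq_sub_of_hasDerivAt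
      (fun τ _ => hasDerivAt_comp_atHeight hφ y τ) (hdy.intervalIntegrable _ _),
      intervalIntegral.integral_of_le htc.1, integral_Ioc_eq_integral_Ioo]
    calc ‖∫ τ in Ioo c t, partialD 2 φ (atHeight y τ)‖ₑ ^ 2
        ≤ (∫⁻ τ in I, ‖partialD 2 φ (atHeight y τ)‖ₑ) ^ 2 := by
          gcongr
          exact (enorm_integral_le_lintegral_enorm _).trans
            (lintegral_mono_set ((Ioo_subset_Ioo_right htc.2).trans hI'))
      _ ≤ volume.restrict I univ * ∫⁻ τ in I, ‖partialD 2 φ (atHeight y τ)‖ₑ ^ 2 :=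
          sq_lintegral_le _ hdy.measurable.enorm.aemeasurable
      _ ≤ _ := by
          rw [Measure.restrict_apply_univ]
          gcongr
  calc ∫⁻ t in I, ‖φ (atHeight y t) - φ (atHeight (hat (atHeight y t)) c)‖ₑ ^ 2
      ≤ ∫⁻ _ in I, ENNReal.ofReal s * ∫⁻ t in I, ‖partialD 2 φ (atHeight y t)‖ₑ ^ 2 :=
        setLIntegral_mono' hIm hpt
    -- In squared norms, one factor $s$ comes from Cauchy–Schwarz, the other from integrating a
    -- constant over $I$.
    _ ≤ ENNReal.ofReal s ^ 2 * ∫⁻ t in I, ‖partialD 2 φ (atHeight y t)‖ₑ ^ 2 := by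
        rw [setLIntegral_const, sq, mul_comm, ← mul_assoc]
        gcongr

/-! ### Traces on horizontal planes -/

/-- The trace on a plane in terms of the values of `f` and its vertical derivative above it. -/
noncomputable def sliceTrace (f : E3 → ℝ) (c : ℝ) (y : E2) : ℝ :=
  ∫ t in Ioo c (c + 1), (f (atHeight y t) - (c + 1 - t) * weakPartial 2 f (atHeight y t))

/-- The weight $c+1-t$ is 1 at the plane and 0 at the top, so the integral of the derivative of
$-(c+1-t)\varphi$ leaves only the value on the plane. -/
lemma eq_integral_slice {φ : E3 → ℝ} (hφ : ContDiff ℝ ∞ φ) (y : E2) (c : ℝ) :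
    φ (atHeight y c) = ∫ t in Ioo c (c + 1),
      (φ (atHeight y t) - (c + 1 - t) * partialD 2 φ (atHeight y t)) := by
  have hd : ∀ t ∈ uIcc c (c + 1), HasDerivAt (fun t => -((c + 1 - t) * φ (atHeight y t)))
      (φ (atHeight y t) - (c + 1 - t) * partialD 2 φ (atHeight y t)) t := by
    intro t _
    have h1 : HasDerivAt (fun t : ℝ => c + 1 - t) (-1) t := by
      simpa using (hasDerivAt_id t).const_sub (c + 1)
    exact (h1.mul (hasDerivAt_comp_atHeight hφ y t)).neg.congr_deriv (by ring)
  have hc : Continuous fun t => φ (atHeight y t) - (c + 1 - t) * partialD 2 φ (atHeight y t) :=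
    (hφ.continuous.comp (continuous_atHeight_right y)).sub ((by fun_prop : Continuous
      fun t : ℝ => c + 1 - t).mul
        ((continuous_partialD hφ 2).comp (continuous_atHeight_right y)))
  rw [← integral_Ioc_eq_integral_Ioo, ← intervalIntegral.integral_of_le (by linarith),
    intervalIntegral.integral_eq_sub_of_hasDerivAt hd (hc.intervalIntegrable _ _)]
  ring

/-- The mollifications of `f` converge to `f` in `H¹_loc`. -/
lemma MemH1loc.tendsto_mollify {f : E3 → ℝ} (hf : MemH1loc f) {K : Set E3} (hK : IsCompact K) :
    Tendsto (fun k => eLpNorm (fun x => mollify (shrinkingBump k) f x - f x) 2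
      (volume.restrict K)) atTop (𝓝 0) ∧
    ∀ j, Tendsto (fun k => eLpNorm (fun x => partialD j (mollify (shrinkingBump k) f) x
      - weakPartial j f x) 2 (volume.restrict K)) atTop (𝓝 0) := by
  refine ⟨tendsto_eLpNorm_mollify_sub tendsto_shrinkingBump
    (hasWeakPartial_weakPartial (hf.2 0).1).1 hf.1 hK, fun j => ?_⟩
  have h := hasWeakPartial_weakPartial (hf.2 j).1
  simp only [fun k => partialD_mollify (shrinkingBump k) h]
  exact tendsto_eLpNorm_mollify_sub tendsto_shrinkingBump h.2.1 (hf.2 j).2 hK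

lemma MemH1loc.contDiff_mollify {f : E3 → ℝ} (hf : MemH1loc f) (η : ContDiffBump (0 : E3)) :
    ContDiff ℝ ∞ (mollify η f) :=
  LawrenceDoniach.contDiff_mollify η (hasWeakPartial_weakPartial (hf.2 0).1).1

/-- The slice integral reproduces the values of the mollifications on the plane and is controlled by
$f$ and $\partial_3f$ in $L^2$, so it inherits their $H^1_{loc}$ convergence. -/
lemma MemH1loc.isTrace_sliceTrace {f : E3 → ℝ} (hf : MemH1loc f) (c : ℝ) :
    IsTrace f c (sliceTrace f c) := by
  set J := Ioo c (c + 1) with hJ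
  have hJv : volume J ≤ 1 := by simp [hJ]
  have hJm : MeasurableSet J := measurableSet_Ioo
  set u : E3 → ℝ := fun x => f x - (c + 1 - x 2) * weakPartial 2 f x with hu
  have hT : sliceTrace f c = fun y => ∫ t in J, u (atHeight y t) := rfl
  have hsub : ∀ K : Set E2, slab K J ⊆ slab K (Icc c (c + 1)) := fun K =>
    slab_mono subset_rfl Ioo_subset_Icc_self
  -- The weight $c+1-x_3$ lies between 0 and 1 on the slab.
  have hbound : ∀ (K : Set E2) (g : E3 → ℝ), IsCompact K →
      AEStronglyMeasurable g (volume.restrict (slab K J)) →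
      AEStronglyMeasurable (fun x => (c + 1 - x 2) * g x) (volume.restrict (slab K J)) ∧
      eLpNorm (fun x => (c + 1 - x 2) * g x) 2 (volume.restrict (slab K J))
        ≤ eLpNorm g 2 (volume.restrict (slab K J)) := by
    intro K g hK hg
    refine ⟨(Continuous.aestronglyMeasurable (by fun_prop)).mul hg, eLpNorm_mono_ae ?_⟩
    filter_upwards [ae_restrict_mem (measurableSet_slab hK.measurableSet hJm)] with x hx
    obtain ⟨h1, h2⟩ := hx.2
    rw [norm_mul, Real.norm_eq_abs, abs_of_nonneg (by linarith)]
    exact mul_le_of_le_one_left (norm_nonneg _) (by linarith)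
  have hfK : ∀ K : Set E2, IsCompact K → MemLp f 2 (volume.restrict (slab K J)) := fun K hK =>
    (hf.1 _ (isCompact_slab hK isCompact_Icc)).mono_measure (Measure.restrict_mono (hsub K) le_rfl)
  have hgK : ∀ K : Set E2, IsCompact K →
      MemLp (weakPartial 2 f) 2 (volume.restrict (slab K J)) := fun K hK =>
    ((hf.2 2).2 _ (isCompact_slab hK isCompact_Icc)).mono_measure
      (Measure.restrict_mono (hsub K) le_rfl)
  have huK : ∀ K : Set E2, IsCompact K → MemLp u 2 (volume.restrict (slab K J)) := fun K hK =>
    (hfK K hK).sub ⟨(hbound K _ hK (hgK K hK).1).1,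
      (hbound K _ hK (hgK K hK).1).2.trans_lt (hgK K hK).2⟩
  have hmeas : ∀ K : Set E2, IsCompact K →
      AEStronglyMeasurable (fun p : E2 × ℝ => u (atHeight p.1 p.2))
        ((volume.restrict K).prod (volume.restrict J)) := fun K hK =>
    (huK K hK).1.comp_quasiMeasurePreserving
      measurePreserving_atHeight_restrict.quasiMeasurePreserving
  have hcontd : ∀ k, ContDiff ℝ ∞ (mollify (shrinkingBump k) f) := fun k =>
    hf.contDiff_mollify _
  refine ⟨hf, fun K hK => ?_, fun k => mollify (shrinkingBump k) f, hcontd,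
    fun K hK => hf.tendsto_mollify hK, fun K hK => ?_⟩
  · rw [hT]
    exact ⟨(hmeas K hK).integral_prod_right',
      (eLpNorm_integral_slice_le hJv (huK K hK).1).trans_lt (huK K hK).2⟩
  have hlim := hf.tendsto_mollify (isCompact_slab hK (isCompact_Icc (a := c) (b := c + 1)))
  have hlim2 := hlim.1.add (hlim.2 2)
  rw [add_zero] at hlim2
  refine tendsto_of_tendsto_of_tendsto_of_le_of_le tendsto_const_nhds hlim2
    (fun _ => zero_le) fun k => ?_
  set φ := mollify (shrinkingBump k) f with hφ
  have hφc := (hcontd k).continuous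
  have hdc := continuous_partialD (hcontd k) 2
  set uk : E3 → ℝ := fun x => φ x - (c + 1 - x 2) * partialD 2 φ x with huk
  have hukc : Continuous uk := hφc.sub ((by fun_prop : Continuous
      fun x : E3 => c + 1 - x 2).mul hdc)
  have hukK : MemLp uk 2 (volume.restrict (slab K J)) :=
    (memL2loc_of_continuous hukc _ (isCompact_slab hK isCompact_Icc)).mono_measure
      (Measure.restrict_mono (hsub K) le_rfl)
  -- Only almost everywhere: $u$ is known to be integrable on almost every vertical segment.
  have hae : (fun y => φ (atHeight y c) - sliceTrace f c y)
      =ᵐ[volume.restrict K] fun y => ∫ t in J, (uk - u) (atHeight y t) := by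
    have : IsFiniteMeasure (volume.restrict K) := ⟨by simpa using hK.measure_lt_top⟩
    have : IsFiniteMeasure (volume.restrict J) := ⟨by simpa using hJv.trans_lt ENNReal.one_lt_top⟩
    have hup : MemLp (fun p : E2 × ℝ => u (atHeight p.1 p.2)) 2
        ((volume.restrict K).prod (volume.restrict J)) :=
      (huK K hK).comp_measurePreserving measurePreserving_atHeight_restrict
    filter_upwards [(hup.integrable one_le_two).prod_right_ae] with y hy
    have hy2 : Integrable (fun t => uk (atHeight y t)) (volume.restrict J) :=
      ((hukc.comp (continuous_atHeight_right y)).integrableOn_Icc (a := c) (b := c + 1)).mono_set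
        Ioo_subset_Icc_self
    rw [hT, hφ, eq_integral_slice (hcontd k) y c]
    exact (integral_sub hy2 hy).symm
  rw [eLpNorm_congr_ae hae]
  refine (eLpNorm_integral_slice_le hJv (hukK.sub (huK K hK)).1).trans ?_
  have hdiff := hdc.aestronglyMeasurable.sub (hgK K hK).1
  have hb := hbound K _ hK hdiff
  have hs : uk - u = (fun x => φ x - f x)
      - fun x => (c + 1 - x 2) * (partialD 2 φ - weakPartial 2 f) x := by
    ext x; simp only [huk, hu, Pi.sub_apply]; ring
  rw [hs]
  refine (eLpNorm_sub_le (hφc.aestronglyMeasurable.sub (hfK K hK).1) hb.1 one_le_two).trans ?_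
  refine add_le_add ?_ (hb.2.trans ?_) <;>
  exact eLpNorm_mono_measure _ (Measure.restrict_mono (hsub K) le_rfl)

/-- Mollification sees only the a.e. class, so $f$ and $B$ have the same mollifications; these
converge to $B$ uniformly on compact sets, including those inside the null plane. -/
lemma MemH1loc.isTrace_of_continuous {f B : E3 → ℝ} (hf : MemH1loc f) (hB : Continuous B)
    (h : B =ᵐ[volume] f) (c : ℝ) : IsTrace f c (fun y => B (atHeight y c)) := by
  have hcy := continuous_atHeight_left c
  refine ⟨hf, memL2loc_of_continuous (hB.comp hcy), fun k => mollify (shrinkingBump k) f,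
    fun k => hf.contDiff_mollify _, fun K hK => hf.tendsto_mollify hK, fun K hK => ?_⟩
  have hu := tendstoUniformlyOn_mollify tendsto_shrinkingBump hB (hK.image hcy)
  rw [ENNReal.tendsto_nhds_zero]
  intro ε hε
  obtain ⟨C, hC0, hC⟩ := ENNReal.exists_nnreal_pos_mul_lt
    (a := volume.restrict K univ ^ (2 : ℝ≥0∞).toReal⁻¹) (b := ε)
    (ENNReal.rpow_ne_top_of_nonneg (by simp) (by simpa using hK.measure_lt_top.ne)) hε.ne'
  filter_upwards [Metric.tendstoUniformlyOn_iff.1 hu C (by exact_mod_cast hC0)] with k hk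
  refine (eLpNorm_le_of_ae_bound (C := C) ?_).trans ?_
  · filter_upwards [ae_restrict_mem hK.measurableSet] with y hy
    rw [← dist_eq_norm, dist_comm, ← mollify_congr _ h]
    exact (hk _ (mem_image_of_mem _ hy)).le
  · rw [mul_comm, ENNReal.ofReal_coe_nnreal]
    exact hC.le

/-- The distance in `L²` of `f` to its trace on a face of a thin slab. -/
lemma IsTrace.eLpNorm_sub_le {f : E3 → ℝ} {c : ℝ} {T : E2 → ℝ} (h : IsTrace f c T)
    {S : Set E2} (hS : Bornology.IsBounded S) {I : Set ℝ} {s : ℝ}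
    (hIm : MeasurableSet I) (hI : I ⊆ Icc c (c + s)) (hI' : Ioo c (c + s) ⊆ I) :
    eLpNorm (fun x => T (hat x) - f x) 2 (volume.restrict (slab S I))
      ≤ ENNReal.ofReal s * eLpNorm (weakPartial 2 f) 2 (volume.restrict (slab S I)) := by
  obtain ⟨hf, hT, φ, hφ, hφK, hφT⟩ := h
  have hvol : volume I ≠ ⊤ := (measure_mono (μ := volume) hI).trans_lt (by simp) |>.ne
  set μ := volume.restrict (slab S I) with hμ
  -- The convergences defining a trace are on compact sets, hence the passage to closures.
  have hSK : S ⊆ closure S := subset_closure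
  have hK : IsCompact (closure S) := hS.isCompact_closure
  have hK3 := isCompact_slab hK (isCompact_Icc (a := c) (b := c + s))
  have hμle : μ ≤ volume.restrict (slab (closure S) (Icc c (c + s))) :=
    Measure.restrict_mono (slab_mono hSK hI) le_rfl
  have hTS : MemLp T 2 (volume.restrict S) := (hT _ hK).mono_measure
    (Measure.restrict_mono hSK le_rfl)
  have hfm : AEStronglyMeasurable f μ := ((hf.1 _ hK3).mono_measure hμle).1
  have hgm : AEStronglyMeasurable (weakPartial 2 f) μ :=
    (((hf.2 2).2 _ hK3).mono_measure hμle).1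
  have l1 : Tendsto (fun k => eLpNorm (fun x => φ k x - f x) 2 μ) atTop (𝓝 0) :=
    tendsto_of_tendsto_of_tendsto_of_le_of_le tendsto_const_nhds (hφK _ hK3).1
      (fun _ => zero_le) fun k => eLpNorm_mono_measure _ hμle
  have l2 : Tendsto (fun k => eLpNorm (fun x => partialD 2 (φ k) x - weakPartial 2 f x) 2 μ)
      atTop (𝓝 0) :=
    tendsto_of_tendsto_of_tendsto_of_le_of_le tendsto_const_nhds ((hφK _ hK3).2 2)
      (fun _ => zero_le) fun k => eLpNorm_mono_measure _ hμle
  have hcy := continuous_atHeight_left c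
  have hφm : ∀ k, AEStronglyMeasurable (fun y => φ k (atHeight y c) - T y) (volume.restrict S) :=
    fun k => ((hφ k).continuous.comp hcy).aestronglyMeasurable.sub hTS.1
  have l3 : Tendsto (fun k => eLpNorm (fun x => φ k (atHeight (hat x) c) - T (hat x)) 2 μ)
      atTop (𝓝 0) := by
    have h1 : Tendsto (fun k => eLpNorm (fun y => φ k (atHeight y c) - T y) 2
        (volume.restrict S)) atTop (𝓝 0) :=
      tendsto_of_tendsto_of_tendsto_of_le_of_le tendsto_const_nhds (hφT _ hK)
        (fun _ => zero_le) fun k => eLpNorm_mono_measure _ (Measure.restrict_mono hSK le_rfl)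
    have h2 : ∀ k, eLpNorm (fun x => φ k (atHeight (hat x) c) - T (hat x)) 2 μ
        = volume I ^ (1 / 2 : ℝ) * eLpNorm (fun y => φ k (atHeight y c) - T y) 2
          (volume.restrict S) := by
      intro k
      refine (ENNReal.pow_right_strictMono two_ne_zero).injective ?_
      rw [eLpNorm_comp_hat_sq (hφm k), mul_pow,
        ← ENNReal.rpow_natCast (_ ^ _), ← ENNReal.rpow_mul]
      norm_num
    simp only [h2]
    simpa using ENNReal.Tendsto.const_mul (a := volume I ^ (1 / 2 : ℝ)) h1
      (Or.inr (ENNReal.rpow_ne_top_of_nonneg (by norm_num) hvol))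
  have hlim : Tendsto (fun k => eLpNorm (fun x => φ k (atHeight (hat x) c) - T (hat x)) 2 μ
      + (ENNReal.ofReal s * (eLpNorm (fun x => partialD 2 (φ k) x - weakPartial 2 f x) 2 μ
        + eLpNorm (weakPartial 2 f) 2 μ) + eLpNorm (fun x => φ k x - f x) 2 μ)) atTop
      (𝓝 (0 + (ENNReal.ofReal s * (0 + eLpNorm (weakPartial 2 f) 2 μ) + 0))) :=
    l3.add ((ENNReal.Tendsto.const_mul (l2.add tendsto_const_nhds) (Or.inr (by simp))).add l1)
  simp only [zero_add, add_zero] at hlim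
  refine ge_of_tendsto' hlim fun k => ?_
  have hφc := (hφ k).continuous
  have hdc := continuous_partialD (hφ k) 2
  have hch : Continuous fun x => φ k (atHeight (hat x) c) := hφc.comp (hcy.comp continuous_hat)
  have m1 : AEStronglyMeasurable (fun x => φ k (atHeight (hat x) c) - T (hat x)) μ :=
    aestronglyMeasurable_comp_hat (hφm k)
  have m2 : AEStronglyMeasurable (fun x => φ k x - φ k (atHeight (hat x) c)) μ :=
    (hφc.sub hch).aestronglyMeasurable
  have m3 : AEStronglyMeasurable (fun x => φ k x - f x) μ := hφc.aestronglyMeasurable.sub hfm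
  -- Of the three terms, the middle one obeys the smooth estimate; the outer ones tend to 0.
  have hsplit : (fun x => T (hat x) - f x)
      = (fun x => φ k x - f x) - (fun x => φ k x - φ k (atHeight (hat x) c))
        - fun x => φ k (atHeight (hat x) c) - T (hat x) := by
    ext x; simp only [Pi.sub_apply]; ring
  have hd : eLpNorm (partialD 2 (φ k)) 2 μ
      ≤ eLpNorm (fun x => partialD 2 (φ k) x - weakPartial 2 f x) 2 μ
        + eLpNorm (weakPartial 2 f) 2 μ := by
    refine le_trans (le_of_eq ?_)
      (eLpNorm_add_le (hdc.aestronglyMeasurable.sub hgm) hgm one_le_two)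
    congr 1; ext x; simp
  rw [hsplit]
  calc _ ≤ eLpNorm (fun x => φ k x - f x) 2 μ
        + eLpNorm (fun x => φ k x - φ k (atHeight (hat x) c)) 2 μ
        + eLpNorm (fun x => φ k (atHeight (hat x) c) - T (hat x)) 2 μ :=
        (_root_.MeasureTheory.eLpNorm_sub_le (m3.sub m2) m1 one_le_two).trans
          (add_le_add_left (_root_.MeasureTheory.eLpNorm_sub_le m3 m2 one_le_two) _)
    _ ≤ eLpNorm (fun x => φ k x - f x) 2 μ
        + ENNReal.ofReal s * (eLpNorm (fun x => partialD 2 (φ k) x - weakPartial 2 f x) 2 μ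
          + eLpNorm (weakPartial 2 f) 2 μ)
        + eLpNorm (fun x => φ k (atHeight (hat x) c) - T (hat x)) 2 μ := by
        gcongr
        exact (eLpNorm_sub_slice_le (hφ k) S hIm hI hI').trans (by gcongr)
    _ = _ := by ring

/-! ### The layers -/

/-- The interval of heights of the `n`-th layer. -/
def layerInterval (s : ℝ) (n : ℕ) : Set ℝ :=
  if n = 0 then Ioo 0 s else Ico (n * s) ((n + 1) * s)

lemma chi_eq (s : ℝ) (n : ℕ) : chi s n = (layerInterval s n).indicator 1 := rfl

lemma measurableSet_layerInterval (s : ℝ) (n : ℕ) : MeasurableSet (layerInterval s n) := by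
  unfold layerInterval
  split_ifs
  exacts [measurableSet_Ioo, measurableSet_Ico]

lemma layerInterval_subset_Ico (s : ℝ) (n : ℕ) :
    layerInterval s n ⊆ Ico (n * s) ((n + 1) * s) := by
  unfold layerInterval
  split_ifs with h
  · subst h; simpa using Ioo_subset_Ico_self
  · exact subset_rfl

lemma Ioo_subset_layerInterval (s : ℝ) (n : ℕ) :
    Ioo (n * s) ((n + 1) * s) ⊆ layerInterval s n := by
  unfold layerInterval
  split_ifs with h
  · subst h; simp
  · exact Ioo_subset_Ico_self

lemma disjoint_layerInterval {s : ℝ} (hs : 0 < s) :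
    Pairwise (Function.onFun Disjoint (layerInterval s)) := by
  have key : ∀ m n : ℕ, m < n → Disjoint (layerInterval s m) (layerInterval s n) := by
    intro m n hmn
    rw [Set.disjoint_left]
    intro x hx hx'
    have h1 := (layerInterval_subset_Ico s m hx).2
    have h2 := (layerInterval_subset_Ico s n hx').1
    have h3 : (m : ℝ) + 1 ≤ n := by exact_mod_cast hmn
    nlinarith
  intro m n hmn
  rcases lt_or_gt_of_ne hmn with h | h
  exacts [key m n h, (key n m h).symm]

lemma iUnion_layerInterval {s : ℝ} (hs : 0 < s) (N : ℕ) :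
    ⋃ n ∈ Finset.range N, layerInterval s n = Ioo 0 (N * s) := by
  ext x
  simp only [mem_iUnion, Finset.mem_range, exists_prop]
  constructor
  · rintro ⟨n, hn, hx⟩
    have h3 : (n : ℝ) + 1 ≤ N := by exact_mod_cast hn
    have h1 := layerInterval_subset_Ico s n hx
    refine ⟨?_, by nlinarith [h1.2]⟩
    by_cases h0 : n = 0
    · subst h0
      simp only [layerInterval, if_true] at hx
      exact hx.1
    · have : (0 : ℝ) < n := by exact_mod_cast Nat.pos_of_ne_zero h0
      exact (mul_pos this hs).trans_le h1.1
  · rintro ⟨h0, hN⟩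
    have hxs : 0 ≤ x / s := (div_pos h0 hs).le
    -- The layer of $x$ is the integer part of $x/s$; in layer 0 the open left end is met because
    -- $x>0$.
    refine ⟨⌊x / s⌋₊, (Nat.floor_lt hxs).2 ((div_lt_iff₀ hs).2 hN), ?_⟩
    unfold layerInterval
    split_ifs with h
    · exact ⟨h0, by simpa using (div_lt_iff₀ hs).1 (Nat.floor_eq_zero.1 h)⟩
    · exact ⟨(le_div_iff₀ hs).1 (Nat.floor_le hxs), (div_lt_iff₀ hs).1 (Nat.lt_floor_add_one _)⟩

lemma slab_eq_biUnion {s : ℝ} (hs : 0 < s) (N : ℕ) (S : Set E2) :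
    slab S (Ioo 0 (N * s)) = ⋃ n ∈ Finset.range N, slab S (layerInterval s n) := by
  rw [← iUnion_layerInterval hs N]
  ext x
  simp [slab]

lemma lintegral_slab_eq_sum {s : ℝ} (hs : 0 < s) (N : ℕ) {S : Set E2} (hS : MeasurableSet S)
    (F : E3 → ℝ≥0∞) : ∫⁻ x in slab S (Ioo 0 (N * s)), F x
      = ∑ n ∈ Finset.range N, ∫⁻ x in slab S (layerInterval s n), F x := by
  rw [slab_eq_biUnion hs, lintegral_biUnion_finset]
  · intro m _ n _ hmn
    exact Set.disjoint_left.2 fun x hx hx' =>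
      Set.disjoint_left.1 (disjoint_layerInterval hs hmn) hx.2 hx'.2
  · exact fun n _ => measurableSet_slab hS (measurableSet_layerInterval s n)

/-- The function equal to `T n` on the `n`-th layer. -/
noncomputable def layeredSum (s : ℝ) (N : ℕ) (T : ℕ → E2 → ℝ) (x : E3) : ℝ :=
  ∑ n ∈ Finset.range N, chi s n (x 2) * T n (hat x)

lemma layeredSum_eq {s : ℝ} (hs : 0 < s) {N n : ℕ} (hn : n < N) (T : ℕ → E2 → ℝ) {x : E3}
    (hx : x 2 ∈ layerInterval s n) : layeredSum s N T x = T n (hat x) := by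
  rw [layeredSum, Finset.sum_eq_single_of_mem n (Finset.mem_range.2 hn)]
  · simp [chi_eq, indicator_of_mem hx]
  · intro m _ hmn
    rw [chi_eq, indicator_of_notMem, zero_mul]
    exact fun h => Set.disjoint_left.1 (disjoint_layerInterval hs hmn) h hx

lemma memLp_layeredSum {S : Set E2} {L : ℝ} (hS : Bornology.IsBounded S) (s : ℝ) {N : ℕ}
    {T : ℕ → E2 → ℝ} (hT : ∀ n < N, MemL2loc (T n)) :
    MemLp (layeredSum s N T) 2 (volume.restrict (slab S (Ioo 0 L))) := by
  refine memLp_finsetSum _ fun n hn => ?_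
  have h1 : MemLp (T n) 2 (volume.restrict S) :=
    (hT n (Finset.mem_range.1 hn) _ hS.isCompact_closure).mono_measure
      (Measure.restrict_mono subset_closure le_rfl)
  have h2 := memLp_comp_hat (I := Ioo 0 L) (by simp) h1
  have hm : MeasurableSet {x : E3 | x 2 ∈ layerInterval s n} :=
    (Continuous.measurable (by fun_prop : Continuous fun x : E3 => x 2))
      (measurableSet_layerInterval s n)
  refine (h2.indicator hm).ae_eq (ae_of_all _ fun x => ?_)
  by_cases hx : x 2 ∈ layerInterval s n
  · simp [chi_eq, hx]
  · simp [chi_eq, hx]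

/-- Squared norms are additive over the disjoint layers, and each layer contributes the same factor
$s^2$, so the constant does not grow with $N$. -/
lemma eLpNorm_layeredSum_sub_le {s : ℝ} (hs : 0 < s) {N : ℕ} {S : Set E2} (hSm : MeasurableSet S)
    (hS : Bornology.IsBounded S) {f : E3 → ℝ} {T : ℕ → E2 → ℝ}
    (hT : ∀ n < N, IsTrace f (n * s) (T n)) :
    eLpNorm (fun x => layeredSum s N T x - f x) 2 (volume.restrict (slab S (Ioo 0 (N * s))))
      ≤ ENNReal.ofReal s
        * eLpNorm (weakPartial 2 f) 2 (volume.restrict (slab S (Ioo 0 (N * s)))) := by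
  rw [← ENNReal.pow_le_pow_left_iff two_ne_zero, mul_pow, eLpNorm_two_sq, eLpNorm_two_sq,
    lintegral_slab_eq_sum hs N hSm, lintegral_slab_eq_sum hs N hSm, Finset.mul_sum]
  refine Finset.sum_le_sum fun n hn => ?_
  have hn' := Finset.mem_range.1 hn
  have hadd : ((n : ℝ) + 1) * s = n * s + s := by ring
  have key := (hT n hn').eLpNorm_sub_le hS (measurableSet_layerInterval s n)
    (hadd ▸ (layerInterval_subset_Ico s n).trans Ico_subset_Icc_self)
    (hadd ▸ Ioo_subset_layerInterval s n)
  rw [← ENNReal.pow_le_pow_left_iff two_ne_zero, mul_pow, eLpNorm_two_sq, eLpNorm_two_sq] at key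
  refine le_of_eq_of_le (setLIntegral_congr_fun
    (measurableSet_slab hSm (measurableSet_layerInterval s n)) fun x hx => ?_) key
  simp only [layeredSum_eq hs hn' T hx.2]

/-! ### The rescaled potentials -/

lemma partialD_two_eq_zero {u : E3 → ℝ} (hu : ContDiff ℝ ∞ u)
    (h : ∀ y t, u (atHeight y t) = u (atHeight y 0)) : partialD 2 u = 0 := by
  ext x
  have h1 := hasDerivAt_comp_atHeight hu (hat x) (x 2)
  simp only [h (hat x), atHeight_hat] at h1
  exact h1.unique (hasDerivAt_const _ _)

lemma MemL2loc.memLp_slab {f : E3 → ℝ} (hf : MemL2loc f) {S : Set E2}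
    (hS : Bornology.IsBounded S) (L : ℝ) : MemLp f 2 (volume.restrict (slab S (Ioo 0 L))) :=
  (hf _ (isCompact_slab hS.isCompact_closure isCompact_Icc)).mono_measure
    (Measure.restrict_mono (slab_mono subset_closure Ioo_subset_Icc_self) le_rfl)

/-- The term $d\,u$ has no vertical derivative, so it adds nothing to the layer error and enters
only through $(lf+du)/l-f=(d/l)u$. -/
lemma eLpNorm_layeredSum_rescaled_le {f u : E3 → ℝ} (hf : MemH1loc f) (hu : ContDiff ℝ ∞ u)
    (hu0 : ∀ y t, u (atHeight y t) = u (atHeight y 0)) {l d : ℝ} (hl : l ≠ 0) {s : ℝ} (hs : 0 < s)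
    {N : ℕ} {S : Set E2} (hSm : MeasurableSet S) (hS : Bornology.IsBounded S) {T : ℕ → E2 → ℝ}
    (hT : ∀ n < N, IsTrace (fun x => l * f x + d * u x) (n * s) (T n)) :
    eLpNorm (fun x => l⁻¹ * layeredSum s N T x - f x) 2
        (volume.restrict (slab S (Ioo 0 (N * s))))
      ≤ ENNReal.ofReal s
          * eLpNorm (weakPartial 2 f) 2 (volume.restrict (slab S (Ioo 0 (N * s))))
        + ‖d / l‖ₑ * eLpNorm u 2 (volume.restrict (slab S (Ioo 0 (N * s)))) := by
  set μ := volume.restrict (slab S (Ioo 0 (N * s))) with hμ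
  set F : E3 → ℝ := fun x => l * f x + d * u x with hF
  have hFH : MemH1loc F := hf.linear_comb_contDiff hu l d
  have hwp : weakPartial 2 F =ᵐ[volume] fun x => l * weakPartial 2 f x := by
    have h := ((hasWeakPartial_weakPartial (hf.2 2).1).linear_comb
      (hasWeakPartial_of_contDiff hu 2) l d).weakPartial_ae_eq
    simpa [partialD_two_eq_zero hu hu0] using h
  have h1 : eLpNorm (weakPartial 2 F) 2 μ = ‖l‖ₑ * eLpNorm (weakPartial 2 f) 2 μ := by
    rw [eLpNorm_congr_ae (ae_restrict_of_ae hwp)]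
    exact eLpNorm_const_smul l _ 2 μ
  have hsplit : (fun x => l⁻¹ * layeredSum s N T x - f x)
      = (l⁻¹ • fun x => layeredSum s N T x - F x) + ((d / l) • u) := by
    ext x
    simp only [hF, Pi.add_apply, Pi.smul_apply, smul_eq_mul]
    field_simp
    ring
  have m1 : AEStronglyMeasurable (fun x => layeredSum s N T x - F x) μ :=
    (memLp_layeredSum hS s fun n hn => (hT n hn).2.1).1.sub (hFH.1.memLp_slab hS _).1
  rw [hsplit]
  refine (eLpNorm_add_le (m1.const_smul _) (hu.continuous.aestronglyMeasurable.const_smul _)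
    one_le_two).trans ?_
  rw [eLpNorm_const_smul, eLpNorm_const_smul]
  refine add_le_add_left ?_ _
  calc ‖l⁻¹‖ₑ * eLpNorm (fun x => layeredSum s N T x - F x) 2 μ
      ≤ ‖l⁻¹‖ₑ * (ENNReal.ofReal s * (‖l‖ₑ * eLpNorm (weakPartial 2 f) 2 μ)) := by
        rw [← h1]
        gcongr
        exact eLpNorm_layeredSum_sub_le hs hSm hS hT
    _ = (‖l⁻¹‖ₑ * ‖l‖ₑ) * (ENNReal.ofReal s * eLpNorm (weakPartial 2 f) 2 μ) := by ring
    _ = _ := by rw [← enorm_mul, inv_mul_cancel₀ hl, enorm_one, one_mul]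

/-! ### Vector fields -/

lemma eq_sum_components (f : E3 → E2) : f = (fun x => f x 0 • EuclideanSpace.single 0 (1 : ℝ))
    + fun x => f x 1 • EuclideanSpace.single 1 (1 : ℝ) := by
  ext x i
  fin_cases i <;> simp

lemma memLp_smul_single {μ : Measure E3} {g : E3 → ℝ} (hg : MemLp g 2 μ) (i : Fin 2) :
    MemLp (fun x => g x • EuclideanSpace.single i (1 : ℝ)) 2 μ :=
  hg.of_le (hg.1.smul_const _) (ae_of_all _ fun x => by simp [norm_smul])

lemma memLp_of_components {μ : Measure E3} {f : E3 → E2} (h0 : MemLp (fun x => f x 0) 2 μ)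
    (h1 : MemLp (fun x => f x 1) 2 μ) : MemLp f 2 μ := by
  rw [eq_sum_components f]
  exact (memLp_smul_single h0 0).add (memLp_smul_single h1 1)

lemma eLpNorm_le_components {μ : Measure E3} {f : E3 → E2} (hf : MemLp f 2 μ) :
    eLpNorm f 2 μ ≤ eLpNorm (fun x => f x 0) 2 μ + eLpNorm (fun x => f x 1) 2 μ := by
  have hm : ∀ i : Fin 2, AEStronglyMeasurable
      (fun x => f x i • EuclideanSpace.single i (1 : ℝ)) μ := fun i =>
    ((by fun_prop : Continuous fun y : E2 => y i).comp_aestronglyMeasurable hf.1).smul_const _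
  conv_lhs => rw [eq_sum_components f]
  refine (eLpNorm_add_le (hm 0) (hm 1) one_le_two).trans (add_le_add ?_ ?_) <;>
  exact eLpNorm_mono fun x => by simp [norm_smul]

lemma contDiff_aField (i : Fin 3) : ContDiff ℝ ∞ fun x => aField x i := by
  fin_cases i <;> simp [aField] <;> fun_prop

lemma aField_atHeight (i : Fin 3) (y : E2) (t : ℝ) :
    aField (atHeight y t) i = aField (atHeight y 0) i := by
  fin_cases i <;> simp [aField]

lemma Aeps_apply (h₀ hex ε : ℝ) (A₀ : E3 → E3) (i : Fin 3) :
    (fun x => Aeps h₀ hex ε A₀ x i)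
      = fun x => |Real.log ε| * A₀ x i + (hex - h₀ * |Real.log ε|) * aField x i := by
  ext x; simp [Aeps]

lemma layerSum_apply (ε s : ℝ) (N : ℕ) (T : ℕ → E2 → E2) (x : E3) (i : Fin 2) :
    layerSum ε s N T x i = |Real.log ε|⁻¹ * layeredSum s N (fun n y => T n y i) x := by
  simp only [layerSum, layeredSum, Finset.mul_sum, WithLp.ofLp_sum, Finset.sum_apply,
    PiLp.smul_apply, smul_eq_mul]
  exact Finset.sum_congr rfl fun n _ => by ring

end LawrenceDoniach

/-! ### Assembly for the vector potential. -/

theorem theorem5p1 (Ω : Set E2) (hΩ : IsSmoothSimplyConnectedDomain Ω) (L : ℝ) (hL : 0 < L)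
    (h₀ : ℝ) (hh₀ : 0 ≤ h₀) (hex : ℝ → ℝ)
    (hhex : Tendsto (fun ε => hex ε / |Real.log ε|) (𝓝[>] 0) (𝓝 h₀))
    (v₀ : E3 → E2) (A₀ : E3 → E3) (hmin : IsMinimizer (layeredDomain Ω L) h₀ v₀ A₀) :
    -- the traces on horizontal planes exist
    (∀ ε ∈ Ioo (0 : ℝ) 1, ∀ c : ℝ, ∃ T, IsHatTrace (Aeps h₀ (hex ε) ε A₀) c T) ∧
    -- they are the classical restrictions of a continuous representative
    (∀ ε ∈ Ioo (0 : ℝ) 1, ∀ B : E3 → E2, Continuous B →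
      (∀ᵐ x, B x = hat (Aeps h₀ (hex ε) ε A₀ x)) →
      ∀ c : ℝ, IsHatTrace (Aeps h₀ (hex ε) ε A₀) c (fun y => B (atHeight y c))) ∧
    -- convergence of the layer sums in `L²(D; ℝ²)`
    MemLp (fun x => hat (A₀ x)) 2 (volume.restrict (layeredDomain Ω L)) ∧
    ∀ T : ℝ → ℕ → ℕ → E2 → E2,
      (∀ ε ∈ Ioo (0 : ℝ) 1, ∀ N : ℕ, 1 ≤ N → ∀ n < N,
        IsHatTrace (Aeps h₀ (hex ε) ε A₀) (n * (L / N)) (T ε N n)) →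
      (∀ ε ∈ Ioo (0 : ℝ) 1, ∀ N : ℕ, 1 ≤ N →
        MemLp (layerSum ε (L / N) N (T ε N)) 2 (volume.restrict (layeredDomain Ω L))) ∧
      Tendsto (fun p : ℝ × ℕ =>
          eLpNorm (fun x => layerSum p.1 (L / p.2) p.2 (T p.1 p.2) x - hat (A₀ x)) 2
            (volume.restrict (layeredDomain Ω L)))
        (𝓝[>] (0 : ℝ) ×ˢ atTop) (𝓝 0) := by
  have hA : ∀ i, MemH1loc fun x => A₀ x i := hmin.2.1.1.1
  have hAe : ∀ (ε : ℝ) i, MemH1loc fun x => Aeps h₀ (hex ε) ε A₀ x i := fun ε i => by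
    rw [Aeps_apply]
    exact (hA i).linear_comb_contDiff (contDiff_aField i) _ _
  have hΩm : MeasurableSet Ω := hΩ.isOpen.measurableSet
  set D := layeredDomain Ω L with hD
  have hDs : D = slab Ω (Ioo 0 L) := rfl
  have hA2 : MemLp (fun x => hat (A₀ x)) 2 (volume.restrict D) :=
    memLp_of_components ((hA 0).1.memLp_slab hΩ.bounded L) ((hA 1).1.memLp_slab hΩ.bounded L)
  refine ⟨fun ε _ c => ?_, fun ε _ B hB hBA c => ?_, hA2, fun T hT => ?_⟩
  · exact ⟨fun y => !₂[sliceTrace (fun x => Aeps h₀ (hex ε) ε A₀ x 0) c y,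
      sliceTrace (fun x => Aeps h₀ (hex ε) ε A₀ x 1) c y],
      (hAe ε 0).isTrace_sliceTrace c, (hAe ε 1).isTrace_sliceTrace c⟩
  · have hBi : ∀ i : Fin 2, Continuous fun x => B x i := fun i => by fun_prop
    refine ⟨(hAe ε 0).isTrace_of_continuous (hBi 0) ?_ c,
      (hAe ε 1).isTrace_of_continuous (hBi 1) ?_ c⟩ <;>
    filter_upwards [hBA] with x hx <;> simp [hx]
  have hlayer : ∀ ε ∈ Ioo (0 : ℝ) 1, ∀ N : ℕ, 1 ≤ N →
      MemLp (layerSum ε (L / N) N (T ε N)) 2 (volume.restrict D) := by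
    intro ε hε N hN
    refine memLp_of_components ?_ ?_ <;> simp only [layerSum_apply]
    · exact (memLp_layeredSum hΩ.bounded _ fun n hn => (hT ε hε N hN n hn).1.2.1).const_mul _
    · exact (memLp_layeredSum hΩ.bounded _ fun n hn => (hT ε hε N hN n hn).2.2.1).const_mul _
  refine ⟨hlayer, ?_⟩
  set bound : Fin 3 → ℝ × ℕ → ℝ≥0∞ := fun i p =>
    ENNReal.ofReal (L / p.2) * eLpNorm (weakPartial 2 fun x => A₀ x i) 2 (volume.restrict D)
      + ‖hex p.1 / |Real.log p.1| - h₀‖ₑ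
        * eLpNorm (fun x => aField x i) 2 (volume.restrict D) with hbound
  have hbound0 : ∀ i, Tendsto (bound i) (𝓝[>] (0 : ℝ) ×ˢ atTop) (𝓝 0) := by
    intro i
    have t1 : Tendsto (fun p : ℝ × ℕ => ENNReal.ofReal (L / p.2)) (𝓝[>] (0 : ℝ) ×ˢ atTop)
        (𝓝 0) := by
      have h := ENNReal.tendsto_ofReal (tendsto_const_div_atTop_nhds_zero_nat L)
      rw [ENNReal.ofReal_zero] at h
      exact h.comp tendsto_snd
    have t2 : Tendsto (fun p : ℝ × ℕ => ‖hex p.1 / |Real.log p.1| - h₀‖ₑ)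
        (𝓝[>] (0 : ℝ) ×ˢ atTop) (𝓝 0) := by
      have h := (hhex.sub_const h₀).enorm
      rw [sub_self, enorm_zero] at h
      exact h.comp tendsto_fst
    -- In `ℝ≥0∞` the products tend to 0 because the fixed $L^2(D)$ norms are finite.
    have h := (ENNReal.Tendsto.mul_const t1
      (Or.inr (((hA i).2 2).2.memLp_slab hΩ.bounded L).2.ne)).add
      (ENNReal.Tendsto.mul_const t2
        (Or.inr ((memL2loc_of_continuous (contDiff_aField i).continuous).memLp_slab
          hΩ.bounded L).2.ne))
    simpa [hbound, hDs] using h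
  have hsum := (hbound0 0).add (hbound0 1)
  rw [add_zero] at hsum
  refine tendsto_of_tendsto_of_tendsto_of_le_of_le' tendsto_const_nhds hsum
    (Eventually.of_forall fun _ => zero_le) ?_
  have hε : ∀ᶠ ε : ℝ in 𝓝[>] 0, ε ∈ Ioo (0 : ℝ) 1 := Ioo_mem_nhdsGT one_pos
  filter_upwards [hε.prod_mk (eventually_ge_atTop 1)] with p hp
  obtain ⟨ε, N⟩ := p
  obtain ⟨hε1, hN⟩ := hp
  dsimp only at hε1 hN ⊢
  have hl : |Real.log ε| ≠ 0 := abs_ne_zero.2 (Real.log_neg hε1.1 hε1.2).ne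
  have hN0 : (0 : ℝ) < N := by exact_mod_cast hN
  have hNs : (N : ℝ) * (L / N) = L := by field_simp
  have key : ∀ (i : Fin 3) (τ : ℕ → E2 → ℝ),
      (∀ n < N, IsTrace (fun x => Aeps h₀ (hex ε) ε A₀ x i) (n * (L / N)) (τ n)) →
      eLpNorm (fun x => |Real.log ε|⁻¹ * layeredSum (L / N) N τ x - A₀ x i) 2
        (volume.restrict D) ≤ bound i (ε, N) := by
    intro i τ hτ
    simp only [Aeps_apply] at hτ
    have h := eLpNorm_layeredSum_rescaled_le (hA i) (contDiff_aField i) (aField_atHeight i)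
      hl (div_pos hL hN0) hΩm hΩ.bounded hτ
    -- $N\cdot(L/N)=L$ makes the slab equal to $D$, and $d/l$ becomes $h_{ex}/l-h_0$.
    rwa [hNs, sub_div, mul_div_cancel_right₀ _ hl] at h
  refine (eLpNorm_le_components ((hlayer ε hε1 N hN).sub hA2)).trans (add_le_add ?_ ?_)
  · simpa [layerSum_apply] using key 0 _ fun n hn => (hT ε hε1 N hN n hn).1
  · simpa [layerSum_apply] using key 1 _ fun n hn => (hT ε hε1 N hN n hn).2
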